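/- Consider the delay differential algebraic system $$E\dot x(t)=A_0x(t)+\sum_{i=1}^{m}A_i x(t-\tau_i)+Bw(t),\qquad z(t)=Cx(t),$$ with real matrices $E,A_0,\dots,A_m\in\mathbb R^{n\times n}$, $B\in\mathbb R^{n\times p}$, $C\in\mathbb R^{q\times n}$ and delays $\tau_i>0$. Let $\operatorname{rank}E=n-k$, and let the columns of $U\in\mathbb R^{n\times k}$ and of $V\in\mathbb R^{n\times k}$ be bases of the left and of the right null space of $E$, so that $U^TE=0$ and $EV=0$. Assume that $U^TA_0V$ is nonsingular and that, for $w\equiv 0$, the zero solution is strongly exponentially stable: there is $\varepsilon>0$ such that for every $r\in\mathbb R^m$ with all $r_i\ge 0$ and $\|r-\tau\|<\varepsilon$ there are $K,\alpha>0$ with $$\|x(t)\|\le K e^{-\alpha t}\sup_{s\in[-r_{\max},0]}\|x(s)\|\qquad (t\ge 0)$$ for every solution $x$ of $E\dot x(t)=A_0x(t)+\sum_i A_ix(t-r_i)$, $t\ge 0$. Here $r_{\max}$ is the largest $r_i$ ($0$ if $m=0$), and a solution is a continuous $x:[-r_{\max},\infty)\to\mathbb R^n$ such that $Ex$ is differentiable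 on $[0,\infty)$ (from the right at $0$) and its derivative satisfies the equation. Define the transfer function and the asymptotic transfer function $$T(\lambda)=C\Big(\lambda E-A_0-\sum_{i=1}^m A_ie^{-\lambda\tau_i}\Big)^{-1}B,\qquad T_a(\lambda)=-CV\Big(U^TA_0V+\sum_{i=1}^m U^TA_iV e^{-\lambda\tau_i}\Big)^{-1}U^TB,$$ and let $\sigma_1$ denote the largest singular value and $j$ the imaginary unit. Then for every $\gamma>0$ there is $\Omega>0$ such that for all $\omega>\Omega$ both inverses exist at $\lambda=j\omega$ and $$\sigma_1\big(T(j\omega)-T_a(j\omega)\big)<\gamma .$$ -/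

import Mathlib

open scoped Matrix

noncomputable section

namespace DDAE

/-- Data of the delay differential algebraic system
`E x'(t) = A₀ x(t) + ∑ i, A i x(t - τ i) + B w(t)`, `z(t) = C x(t)`,
with `n` state variables, `m` delayed terms, `p` inputs and `q` outputs
(the delays `τ` are kept separate, because they get perturbed). -/
structure System (n m p q : ℕ) where
  E : Matrix (Fin n) (Fin n) ℝ
  A₀ : Matrix (Fin n) (Fin n) ℝ
  A : Fin m → Matrix (Fin n) (Fin n) ℝ
  B : Matrix (Fin n) (Fin p) ℝ
  C : Matrix (Fin q) (Fin n) ℝ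

/-- A real matrix, seen as a complex matrix. -/
def toComplex {k l : ℕ} (M : Matrix (Fin k) (Fin l) ℝ) : Matrix (Fin k) (Fin l) ℂ :=
  M.map Complex.ofReal

/-- The largest singular value `σ₁(M)` (Mathlib numbers singular values from `0`). -/
def sigmaOne {k l : ℕ} (M : Matrix (Fin k) (Fin l) ℂ) : ℝ :=
  (Matrix.toEuclideanLin M).singularValues 0

/-- The Euclidean norm of a real vector. -/
def euclNorm {k : ℕ} (v : Fin k → ℝ) : ℝ :=
  ‖WithLp.toLp 2 v‖

/-- The largest delay (`0` if there are no delays). -/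
def maxDelay {m : ℕ} (r : Fin m → ℝ) : ℝ :=
  ⨆ i, r i

namespace System

variable {n m p q : ℕ}

/-- The characteristic matrix `λ E - A₀ - ∑ i, A i e^{-λ τ i}`. -/
def charMatrix (S : System n m p q) (τ : Fin m → ℝ) (lam : ℂ) : Matrix (Fin n) (Fin n) ℂ :=
  lam • toComplex S.E - toComplex S.A₀
    - ∑ i, Complex.exp (-lam * (τ i : ℂ)) • toComplex (S.A i)

/-- The transfer function `T(λ) = C (λ E - A₀ - ∑ i, A i e^{-λ τ i})⁻¹ B`. -/
def transfer (S : System n m p q) (τ : Fin m → ℝ) (lam : ℂ) : Matrix (Fin q) (Fin p) ℂ :=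
  toComplex S.C * (S.charMatrix τ lam)⁻¹ * toComplex S.B

/-- The matrix `Uᵀ A₀ V + ∑ i, Uᵀ A i V e^{-λ τ i}`. -/
def algMatrix {k : ℕ} (S : System n m p q) (U V : Matrix (Fin n) (Fin k) ℝ)
    (τ : Fin m → ℝ) (lam : ℂ) : Matrix (Fin k) (Fin k) ℂ :=
  toComplex (Uᵀ * S.A₀ * V)
    + ∑ i, Complex.exp (-lam * (τ i : ℂ)) • toComplex (Uᵀ * S.A i * V)

/-- The asymptotic transfer function
`T_a(λ) = - C V (Uᵀ A₀ V + ∑ i, Uᵀ A i V e^{-λ τ i})⁻¹ Uᵀ B`. -/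
def asympTransfer {k : ℕ} (S : System n m p q) (U V : Matrix (Fin n) (Fin k) ℝ)
    (τ : Fin m → ℝ) (lam : ℂ) : Matrix (Fin q) (Fin p) ℂ :=
  -(toComplex (S.C * V) * (S.algMatrix U V τ lam)⁻¹ * toComplex (Uᵀ * S.B))

/-- `x` is a (forward) solution, with delays `r` and zero input, of
`E x'(t) = A₀ x(t) + ∑ i, A i x(t - r i)` for `t ≥ 0`: it is continuous on `[-r_max, ∞)`, and
`E x` is differentiable on `[0, ∞)` (from the right at `0`) and satisfies the equation there.
The initial function is the restriction of `x` to `[-r_max, 0]`. -/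
structure IsSolution (S : System n m p q) (r : Fin m → ℝ) (x : ℝ → Fin n → ℝ) : Prop where
  continuousOn : ContinuousOn x (Set.Ici (-maxDelay r))
  equation : ∀ t : ℝ, 0 ≤ t →
    HasDerivWithinAt (fun s => S.E *ᵥ x s)
      (S.A₀ *ᵥ x t + ∑ i, S.A i *ᵥ x (t - r i)) (Set.Ici 0) t

/-- Exponential stability of the zero solution for the delays `r` and zero input:
`‖x(t)‖ ≤ K e^{-α t} sup_{s ∈ [-r_max, 0]} ‖x(s)‖` for all `t ≥ 0` and all solutions `x`. -/
def ExpStable (S : System n m p q) (r : Fin m → ℝ) : Prop :=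
  ∃ K α : ℝ, 0 < K ∧ 0 < α ∧ ∀ x : ℝ → Fin n → ℝ, S.IsSolution r x →
    ∀ t : ℝ, 0 ≤ t →
      euclNorm (x t) ≤ K * Real.exp (-α * t) *
        sSup ((fun s => euclNorm (x s)) '' Set.Icc (-maxDelay r) 0)

/-- Strong exponential stability of the zero solution for the delays `τ` and zero input:
exponential stability persists under all sufficiently small perturbations of the delays
(through nonnegative delays). The constants may depend on the perturbed delays. -/
def StronglyExpStable (S : System n m p q) (τ : Fin m → ℝ) : Prop :=
  ∃ ε : ℝ, 0 < ε ∧ ∀ r : Fin m → ℝ, (∀ i, 0 ≤ r i) → euclNorm (r - τ) < ε → S.ExpStable r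

end System

end DDAE

end

/-! Let `P = Uᵀ`, let `W` be a right inverse of `P`, and let `Q = W * P`, a projection with `Q * E =
0`. With `H z = A₀ + ∑ i, z i • A i`, multiplying the characteristic matrix by `λ⁻¹ • (1 - Q) + Q`
gives `E - (μ • (1 - Q) + Q) * H z` at `μ = λ⁻¹`, `z i = exp (-λ τ i)`. This is regular at `μ = 0`,
so high frequencies become the limit `μ → 0` with `z` on a compact torus. At `μ = 0` the rescaled
transfer function is exactly `T_a` (`Matrix.inv_sub_mul_mul`), and joint continuity with compactness
makes the convergence uniform.

This needs `Uᵀ (H z) V` nonsingular on the whole torus, which is where strong stability enters. Were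
it singular at `z`, delays `r` near `τ` would realise `z` at one frequency `ω₀`
(`exists_delays_near`). Powers of `z` return near `z`, so a Hurwitz-type argument near `j ω₀ L`, for
suitable large `L`, yields characteristic roots arbitrarily close to the imaginary axis
(`exists_near_imaginary_zero`), contradicting exponential stability for `r`. -/

open Filter Topology Metric

/-! ### Linear algebra of a singular `E` and its left and right null spaces. -/

namespace Matrix

variable {K : Type*} [Field K] {ι κ : Type*} [Fintype ι] [DecidableEq ι] [Fintype κ]
  [DecidableEq κ]

theorem exists_leftInverse_of_linearIndependent_col {U : Matrix ι κ K}
    (hU : LinearIndependent K U.col) : ∃ L : Matrix κ ι K, L * U = 1 := by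
  have hinj : Function.Injective U.mulVecLin := Matrix.mulVec_injective_iff.mpr hU
  obtain ⟨g, hg⟩ := U.mulVecLin.exists_leftInverse_of_injective (LinearMap.ker_eq_bot.mpr hinj)
  refine ⟨LinearMap.toMatrix' g, ?_⟩
  have h := congrArg LinearMap.toMatrix' hg
  rwa [LinearMap.toMatrix'_comp, LinearMap.toMatrix'_id, ← Matrix.toLin'_apply',
    LinearMap.toMatrix'_toLin'] at h

omit [DecidableEq ι] [DecidableEq κ] in
theorem ker_eq_range_of_rank_add_card {E : Matrix ι ι K} {V : Matrix ι κ K}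
    (hrank : E.rank + Fintype.card κ = Fintype.card ι) (hV : E * V = 0)
    (hVind : LinearIndependent K V.col) :
    LinearMap.ker E.mulVecLin = LinearMap.range V.mulVecLin := by
  symm
  refine Submodule.eq_of_le_of_finrank_le ?_ ?_
  · rintro _ ⟨a, rfl⟩
    simp [Matrix.mulVec_mulVec, hV]
  · have h1 := LinearMap.finrank_range_add_finrank_ker E.mulVecLin
    have h2 := LinearMap.finrank_range_of_inj
      (f := V.mulVecLin) (Matrix.mulVec_injective_iff.mpr hVind)
    simp only [Module.finrank_fintype_fun_eq_card] at h1 h2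
    rw [h2]
    change E.rank + _ = _ at h1
    omega

/-- `E` stacked on `L` is injective, because `ker E` is the range of `V` and `L * V = 1`.
Multiplying a left inverse by `V` shows that its second block is `V` itself. -/
theorem exists_mul_add_mul_eq_one {E : Matrix ι ι K} {V : Matrix ι κ K} {L : Matrix κ ι K}
    (hrank : E.rank + Fintype.card κ = Fintype.card ι) (hV : E * V = 0)
    (hL : L * V = 1) : ∃ X : Matrix ι ι K, X * E + V * L = 1 := by
  have hVind : LinearIndependent K V.col := by
    rw [← Matrix.mulVec_injective_iff]
    intro a b hab
    have := congrArg (L *ᵥ ·) hab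
    simpa [Matrix.mulVec_mulVec, hL] using this
  have hinj : Function.Injective (Matrix.fromRows E L).mulVecLin := by
    rw [← LinearMap.ker_eq_bot, LinearMap.ker_eq_bot']
    intro v hv
    rw [Matrix.mulVecLin_apply, Matrix.fromRows_mulVec] at hv
    have hE : E *ᵥ v = 0 := funext fun i => congrFun hv (Sum.inl i)
    have hLv : L *ᵥ v = 0 := funext fun i => congrFun hv (Sum.inr i)
    have hmem : v ∈ LinearMap.ker E.mulVecLin := hE
    rw [ker_eq_range_of_rank_add_card hrank hV hVind] at hmem
    obtain ⟨a, rfl⟩ := hmem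
    rw [Matrix.mulVecLin_apply, Matrix.mulVec_mulVec, hL, Matrix.one_mulVec] at hLv
    rw [hLv, map_zero]
  obtain ⟨G, hG⟩ := exists_leftInverse_of_linearIndependent_col
    (Matrix.mulVec_injective_iff.mp hinj)
  rw [← Matrix.fromCols_toCols G, Matrix.fromCols_mul_fromRows] at hG
  have hGV : G.toCols₂ = V := by
    have := congrArg (· * V) hG
    simpa [Matrix.add_mul, Matrix.mul_assoc, hV, hL] using this
  exact ⟨G.toCols₁, hGV ▸ hG⟩

/-- For `V` spanning the kernel of `E` and `P` annihilating the range of `E`, with right inverse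
`W`, the matrix `E - W * P * H` is singular exactly when the compression `P * H * V` is. -/
theorem det_sub_mul_eq_zero_iff {E H X : Matrix ι ι K} {P L : Matrix κ ι K} {V W : Matrix ι κ K}
    (hP : P * E = 0) (hV : E * V = 0) (hW : P * W = 1) (hL : L * V = 1)
    (hX : X * E + V * L = 1) :
    (E - W * P * H).det = 0 ↔ (P * H * V).det = 0 := by
  rw [← Matrix.exists_mulVec_eq_zero_iff, ← Matrix.exists_mulVec_eq_zero_iff]
  constructor
  -- Applying `P` kills `E` and leaves `P H v = 0`; then `E v = 0`, so `v = V (L v)`.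
  · rintro ⟨v, hv0, hv⟩
    have h1 : (P * H) *ᵥ v = 0 := by
      have h : -((P * H) *ᵥ v) = 0 := by
        have := congrArg (P *ᵥ ·) hv
        simpa [Matrix.mulVec_mulVec, Matrix.mul_sub, hP, ← Matrix.mul_assoc, hW,
          Matrix.neg_mulVec] using this
      simpa using h
    have h2 : E *ᵥ v = 0 := by
      rw [Matrix.sub_mulVec, Matrix.mul_assoc, ← Matrix.mulVec_mulVec, h1] at hv
      simpa using hv
    have h3 : V *ᵥ (L *ᵥ v) = v := by
      have := congrArg (· *ᵥ v) hX
      simpa [Matrix.add_mulVec, ← Matrix.mulVec_mulVec, h2] using this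
    refine ⟨L *ᵥ v, fun h => hv0 ?_, ?_⟩
    · rw [← h3, h, Matrix.mulVec_zero]
    · rw [← Matrix.mulVec_mulVec, h3, h1]
  · rintro ⟨a, ha0, ha⟩
    refine ⟨V *ᵥ a, fun h => ha0 ?_, ?_⟩
    · have := congrArg (L *ᵥ ·) h
      simpa [Matrix.mulVec_mulVec, hL] using this
    · have h : (E - W * P * H) * V = -(W * (P * H * V)) := by
        rw [Matrix.sub_mul, hV]
        simp [Matrix.mul_assoc]
      rw [Matrix.mulVec_mulVec, h, Matrix.neg_mulVec, ← Matrix.mulVec_mulVec, ha]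
      simp

/-- Source of the formula for `T_a`: since `E * V = 0`, the product of `E - W * P * H` with `V * (P
* H * V)⁻¹ * P` collapses to `-(W * P)`. -/
theorem inv_sub_mul_mul {E H : Matrix ι ι K} {P : Matrix κ ι K} {V W : Matrix ι κ K}
    (hV : E * V = 0) (h1 : IsUnit (E - W * P * H).det) (h2 : IsUnit (P * H * V).det) :
    (E - W * P * H)⁻¹ * (W * P) = -(V * (P * H * V)⁻¹ * P) := by
  have h : (E - W * P * H) * (V * (P * H * V)⁻¹ * P) = -(W * P) := by
    have e : (E - W * P * H) * (V * (P * H * V)⁻¹ * P)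
        = E * V * ((P * H * V)⁻¹ * P) - W * ((P * H * V) * (P * H * V)⁻¹) * P := by
      simp only [Matrix.sub_mul, Matrix.mul_assoc]
    rw [e, hV, Matrix.mul_nonsing_inv _ h2]
    simp
  rw [← neg_eq_iff_eq_neg, ← Matrix.mul_neg, ← h, ← Matrix.mul_assoc,
    Matrix.nonsing_inv_mul _ h1, Matrix.one_mul]

/-- The matrix acts as `μ` and as `1` on complementary subspaces, which gives the inverse at once.
-/
theorem isUnit_det_smul_add_of_isIdempotentElem {Q : Matrix ι ι K} (hQ : IsIdempotentElem Q)
    {μ : K} (hμ : μ ≠ 0) : IsUnit (μ • (1 - Q) + Q).det := by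
  refine Matrix.isUnit_det_of_right_inverse (B := μ⁻¹ • (1 - Q) + Q) ?_
  have h : Q * Q = Q := hQ
  have e : (μ • (1 - Q) + Q) * (μ⁻¹ • (1 - Q) + Q)
      = (μ * μ⁻¹) • ((1 - Q) * (1 - Q)) + μ • ((1 - Q) * Q) + μ⁻¹ • (Q * (1 - Q)) + Q * Q := by
    simp only [Matrix.add_mul, Matrix.mul_add, Matrix.smul_mul, Matrix.mul_smul, mul_smul,
      smul_add]
    rw [smul_comm μ μ⁻¹]
    abel
  rw [e, mul_inv_cancel₀ hμ, hQ.one_sub.eq, hQ.one_sub_mul_self, hQ.mul_one_sub_self, h]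
  simp

end Matrix

/-! ### Singular values and the operator norm. -/

namespace LinearMap

variable {𝕜 : Type*} [RCLike 𝕜]
  {E : Type*} [NormedAddCommGroup E] [InnerProductSpace 𝕜 E] [FiniteDimensional 𝕜 E]
  {F : Type*} [NormedAddCommGroup F] [InnerProductSpace 𝕜 F] [FiniteDimensional 𝕜 F]

/-- The squared singular value is an eigenvalue of `T* T`, and an eigenvector `v` satisfies `‖T v‖ =
σ ‖v‖`. -/
theorem singularValues_le_norm (T : E →ₗ[𝕜] F) (i : ℕ) :
    T.singularValues i ≤ ‖LinearMap.toContinuousLinearMap T‖ := by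
  rcases lt_or_ge i (Module.finrank 𝕜 E) with hi | hi
  · obtain ⟨v, hv⟩ := (T.hasEigenvalue_adjoint_comp_self_sq_singularValues hi).exists_hasEigenvector
    have hv0 : 0 < ‖v‖ := norm_pos_iff.mpr hv.2
    have h1 : (LinearMap.adjoint T) (T v) = ((T.singularValues i ^ 2 : ℝ) : 𝕜) • v := by
      simpa using hv.apply_eq_smul
    have h2 : ‖T v‖ ^ 2 = T.singularValues i ^ 2 * ‖v‖ ^ 2 := by
      have h3 : inner 𝕜 (T v) (T v) = inner 𝕜 v ((LinearMap.adjoint T) (T v)) :=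
        (LinearMap.adjoint_inner_right T v (T v)).symm
      rw [h1, inner_smul_right, inner_self_eq_norm_sq_to_K, inner_self_eq_norm_sq_to_K] at h3
      exact_mod_cast h3
    have h4 : ‖T v‖ = T.singularValues i * ‖v‖ := by
      rw [← mul_pow] at h2
      exact (pow_left_inj₀ (norm_nonneg _)
        (mul_nonneg (T.singularValues_nonneg i) hv0.le) two_ne_zero).mp h2
    have h5 := (LinearMap.toContinuousLinearMap T).le_opNorm v
    simp only [LinearMap.coe_toContinuousLinearMap'] at h5
    rw [h4] at h5
    exact le_of_mul_le_mul_right h5 hv0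
  · rw [T.singularValues_of_finrank_le hi]
    exact norm_nonneg _

end LinearMap

/-! ### Zeros of perturbed holomorphic functions and recurrence on the torus. -/

/-- Without a zero, the maximum principle for `1 / f` would give `‖f 0‖ ≥ δ`. -/
theorem Complex.exists_mem_closedBall_eq_zero {f : ℂ → ℂ} {R δ : ℝ} (hR : 0 < R)
    (hf : DiffContOnCl ℂ f (ball 0 R)) (hδ : 0 < δ) (hsphere : ∀ s ∈ sphere (0 : ℂ) R, δ ≤ ‖f s‖)
    (h0 : ‖f 0‖ < δ) : ∃ s ∈ closedBall (0 : ℂ) R, f s = 0 := by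
  by_contra! hne
  have hinv : DiffContOnCl ℂ f⁻¹ (ball 0 R) := hf.inv fun s hs =>
    hne s (by rwa [closure_ball _ hR.ne'] at hs)
  have hle : ‖f⁻¹ 0‖ ≤ δ⁻¹ := by
    refine Complex.norm_le_of_forall_mem_frontier_norm_le isBounded_ball hinv ?_
      (subset_closure (mem_ball_self hR))
    intro s hs
    rw [frontier_ball _ hR.ne'] at hs
    rw [Pi.inv_apply, norm_inv]
    exact inv_anti₀ hδ (hsphere s hs)
  rw [Pi.inv_apply, norm_inv] at hle
  have hpos : 0 < ‖f 0‖ := norm_pos_iff.mpr (hne 0 (mem_closedBall_self hR.le))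
  exact absurd ((inv_le_inv₀ hpos hδ).mp hle) (not_le.mpr h0)

/-- Zeros of a nontrivial entire function are isolated; a zero at the centre is harmless. -/
theorem Complex.exists_sphere_ne_zero {g : ℂ → ℂ} (hg : Differentiable ℂ g) {s₀ : ℂ}
    (hs₀ : g s₀ ≠ 0) {ρ : ℝ} (hρ : 0 < ρ) :
    ∃ R, 0 < R ∧ R ≤ ρ ∧ ∀ s ∈ sphere (0 : ℂ) R, g s ≠ 0 := by
  have han : AnalyticOnNhd ℂ g Set.univ := fun s _ => hg.analyticAt s
  rcases (han 0 (Set.mem_univ _)).eventually_eq_zero_or_eventually_ne_zero with h | h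
  · exact absurd (han.eqOn_zero_of_preconnected_of_eventuallyEq_zero isPreconnected_univ
      (Set.mem_univ 0) h (Set.mem_univ s₀)) hs₀
  · rw [eventually_nhdsWithin_iff, Metric.eventually_nhds_iff] at h
    obtain ⟨ε, hε, h⟩ := h
    refine ⟨min (ε / 2) ρ, lt_min (by positivity) hρ, min_le_right _ _, fun s hs => ?_⟩
    have hs' : dist s 0 = min (ε / 2) ρ := hs
    refine h ?_ ?_
    · rw [hs']
      exact (min_le_left _ _).trans_lt (by linarith)
    · rintro rfl
      rw [dist_self] at hs'
      exact (lt_min (half_pos hε) hρ).ne hs'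

/-- A zero of the limiting function `Φ 0` on the torus produces zeros of
`lam ↦ Φ lam⁻¹ (exp (-lam * r ·))` arbitrarily close to the imaginary axis. -/
theorem exists_near_imaginary_zero {m : ℕ} {Φ : ℂ → (Fin m → ℂ) → ℂ}
    (hΦ : Differentiable ℂ fun x : ℂ × (Fin m → ℂ) => Φ x.1 x.2) (h00 : Φ 0 0 ≠ 0)
    {r : Fin m → ℝ} (hr : ∀ i, 0 < r i) {ω₀ : ℝ} (hω₀ : 0 < ω₀) {z : Fin m → Circle}
    (hz : ∀ i, (z i : ℂ) = Complex.exp (-(Complex.I * ω₀) * r i))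
    (hzero : Φ 0 (fun i => (z i : ℂ)) = 0) {ρ : ℝ} (hρ : 0 < ρ) :
    ∃ lam : ℂ, lam ≠ 0 ∧ |lam.re| ≤ ρ ∧ Φ lam⁻¹ (fun i => Complex.exp (-lam * r i)) = 0 := by
  set g : ℂ → ℂ := fun s => Φ 0 (fun i => (z i : ℂ) * Complex.exp (-s * r i)) with hg
  have hgd : Differentiable ℂ g := by
    have h : Differentiable ℂ fun s : ℂ =>
        ((0 : ℂ), fun i => (z i : ℂ) * Complex.exp (-s * r i)) := by fun_prop
    exact hΦ.comp h
  -- As `s → +∞` along the reals the exponentials vanish, because `r i > 0`, and `g` tends to `Φ 0 0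
  -- ≠ 0`.
  obtain ⟨s₀, hs₀⟩ : ∃ s₀, g s₀ ≠ 0 := by
    have hlim : Tendsto (fun x : ℝ => g x) atTop (𝓝 (Φ 0 0)) := by
      have h : Tendsto (fun x : ℝ => ((0 : ℂ), fun i => (z i : ℂ) * Complex.exp (-(x : ℂ) * r i)))
          atTop (𝓝 (0, 0)) := by
        refine tendsto_const_nhds.prodMk_nhds (tendsto_pi_nhds.mpr fun i => ?_)
        refine tendsto_zero_iff_norm_tendsto_zero.mpr ?_
        have e : (fun x : ℝ => ‖(z i : ℂ) * Complex.exp (-(x : ℂ) * r i)‖)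
            = fun x => Real.exp (-(x * r i)) := by
          funext x
          rw [norm_mul, Circle.norm_coe, one_mul, Complex.norm_exp]
          simp
        rw [e]
        exact Real.tendsto_exp_neg_atTop_nhds_zero.comp (tendsto_id.atTop_mul_const (hr i))
      exact (hΦ.continuous.tendsto _).comp h
    obtain ⟨x, hx⟩ := (hlim.eventually_ne h00).exists
    exact ⟨x, hx⟩
  obtain ⟨R, hR, hRρ, hRg⟩ := Complex.exists_sphere_ne_zero hgd hs₀ hρ
  obtain ⟨δ, hδ, hδg⟩ : ∃ δ, 0 < δ ∧ ∀ s ∈ sphere (0 : ℂ) R, δ ≤ ‖g s‖ := by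
    obtain ⟨s₁, hs₁, hmin⟩ := (isCompact_sphere (0 : ℂ) R).exists_isMinOn
      (NormedSpace.sphere_nonempty.mpr hR.le) hgd.continuous.norm.continuousOn
    exact ⟨‖g s₁‖, norm_pos_iff.mpr (hRg s₁ hs₁), fun s hs => hmin hs⟩
  -- perturbed family; `ν` stands for `(I * ω)⁻¹`
  set F : ℂ × (Fin m → ℂ) → ℂ → ℂ := fun p s =>
    Φ (p.1 / (1 + p.1 * s)) (fun i => p.2 i * Complex.exp (-s * r i)) with hF
  -- At `p = (0, z)` the family is `g`; compactness of the disc makes the closeness uniform in `s`.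
  have hclose : ∀ᶠ p : ℂ × (Fin m → ℂ) in 𝓝 (0, fun i => (z i : ℂ)),
      ∀ s ∈ closedBall (0 : ℂ) R, 1 + p.1 * s ≠ 0 ∧ ‖F p s - g s‖ < δ / 2 := by
    refine (isCompact_closedBall (0 : ℂ) R).eventually_forall_of_forall_eventually fun s _ => ?_
    have hne : ∀ᶠ x : (ℂ × (Fin m → ℂ)) × ℂ in 𝓝 ((0, fun i => (z i : ℂ)), s),
        1 + x.1.1 * x.2 ≠ 0 := by
      have hc : Continuous fun x : (ℂ × (Fin m → ℂ)) × ℂ => 1 + x.1.1 * x.2 := by fun_prop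
      exact (hc.tendsto _).eventually_ne (by simp)
    refine hne.and ?_
    have hc : ContinuousAt (fun x : (ℂ × (Fin m → ℂ)) × ℂ => ‖F x.1 x.2 - g x.2‖)
        ((0, fun i => (z i : ℂ)), s) := by
      have h1 : ContinuousAt (fun x : (ℂ × (Fin m → ℂ)) × ℂ =>
          (x.1.1 / (1 + x.1.1 * x.2), fun i => x.1.2 i * Complex.exp (-x.2 * r i)))
          ((0, fun i => (z i : ℂ)), s) := by
        refine ContinuousAt.prodMk ?_ (by fun_prop)
        exact ContinuousAt.div (by fun_prop) (by fun_prop) (by simp)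
      have h2 : ContinuousAt (fun x : (ℂ × (Fin m → ℂ)) × ℂ => F x.1 x.2)
          ((0, fun i => (z i : ℂ)), s) :=
        ContinuousAt.comp (g := fun x : ℂ × (Fin m → ℂ) => Φ x.1 x.2)
          hΦ.continuous.continuousAt h1
      exact (h2.sub (hgd.continuous.comp continuous_snd).continuousAt).norm
    refine hc.eventually_lt continuousAt_const ?_
    simpa [hF, hg] using hδ
  rw [nhds_prod_eq] at hclose
  obtain ⟨pν, hpν, pz, hpz, hprod⟩ := eventually_prod_iff.mp hclose
  have hν : Tendsto (fun L : ℕ => (Complex.I * ((ω₀ * L : ℝ) : ℂ))⁻¹) atTop (𝓝 0) := by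
    rw [tendsto_zero_iff_norm_tendsto_zero]
    have e : (fun L : ℕ => ‖(Complex.I * ((ω₀ * L : ℝ) : ℂ))⁻¹‖) = fun L : ℕ => (ω₀ * L)⁻¹ := by
      funext L
      rw [norm_inv, norm_mul, Complex.norm_I, one_mul, Complex.norm_real, Real.norm_of_nonneg
        (by positivity)]
    rw [e]
    exact tendsto_inv_atTop_zero.comp (tendsto_natCast_atTop_atTop.const_mul_atTop hω₀)
  -- Recurrence in a compact group: `z` is a cluster point of its own powers, and `z ^ L` collects
  -- the phases at frequency `ω₀ * L`.
  have hfreq : ∃ᶠ L : ℕ in atTop, pz fun i => ((z ^ L) i : ℂ) := by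
    have hc : Continuous fun y : Fin m → Circle => fun i => (y i : ℂ) := by fun_prop
    have := (mapClusterPt_self_atTop_pow z).frequently ((hc.tendsto z).eventually hpz)
    exact this
  obtain ⟨L, hLz, hLν, hL0⟩ := (hfreq.and_eventually ((hν.eventually hpν).and
    (eventually_gt_atTop 0))).exists
  set ν : ℂ := (Complex.I * ((ω₀ * L : ℝ) : ℂ))⁻¹ with hνdef
  set y : Fin m → ℂ := fun i => ((z ^ L) i : ℂ) with hy
  have hp := hprod hLν hLz
  have hL0' : (0 : ℝ) < L := by exact_mod_cast hL0
  have hiω : Complex.I * ((ω₀ * L : ℝ) : ℂ) ≠ 0 :=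
    mul_ne_zero Complex.I_ne_zero (by exact_mod_cast (mul_pos hω₀ hL0').ne')
  have hFd : DiffContOnCl ℂ (F (ν, y)) (ball 0 R) := by
    have hd : DifferentiableOn ℂ (F (ν, y)) (closedBall 0 R) := by
      have h1 : DifferentiableOn ℂ (fun s : ℂ =>
          (ν / (1 + ν * s), fun i => y i * Complex.exp (-s * r i))) (closedBall 0 R) := by
        refine DifferentiableOn.prodMk ?_ (by fun_prop)
        exact DifferentiableOn.div (by fun_prop) (by fun_prop) fun s hs => (hp s hs).1
      exact hΦ.comp_differentiableOn h1
    refine ⟨hd.mono ball_subset_closedBall, ?_⟩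
    rw [closure_ball _ hR.ne']
    exact hd.continuousOn
  -- On the sphere `‖F‖ ≥ δ - δ / 2`, while at the centre `‖F‖ < δ / 2` because `g 0 = 0`.
  obtain ⟨s, hs, hs0⟩ := Complex.exists_mem_closedBall_eq_zero hR hFd (half_pos hδ)
    (fun s hs => by
      have h1 := (hp s (sphere_subset_closedBall hs)).2
      have h2 := hδg s hs
      have h3 := norm_sub_norm_le (g s) (F (ν, y) s)
      rw [norm_sub_rev] at h3
      linarith)
    (by
      have h1 := (hp 0 (mem_closedBall_self hR.le)).2
      have h2 : g 0 = 0 := by simpa [hg] using hzero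
      rwa [h2, sub_zero] at h1)
  -- For `lam = I * ω₀ * L + s` this turns `lam⁻¹` into `ν / (1 + ν * s)`, the first argument in
  -- `F`.
  have hfac : Complex.I * ((ω₀ * L : ℝ) : ℂ) + s
      = Complex.I * ((ω₀ * L : ℝ) : ℂ) * (1 + ν * s) := by
    rw [mul_add, mul_one, ← mul_assoc, hνdef, mul_inv_cancel₀ hiω, one_mul]
  refine ⟨Complex.I * ((ω₀ * L : ℝ) : ℂ) + s, ?_, ?_, ?_⟩
  · rw [hfac]
    exact mul_ne_zero hiω (hp s hs).1
  · have h1 : (Complex.I * ((ω₀ * L : ℝ) : ℂ) + s).re = s.re := by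
      rw [Complex.add_re, Complex.re_mul_ofReal]
      simp
    rw [h1]
    exact (Complex.abs_re_le_norm s).trans ((mem_closedBall_zero_iff.mp hs).trans hRρ)
  · rw [← hs0, hF]
    congr 1
    · rw [hfac, mul_inv, div_eq_mul_inv]
    · funext i
      rw [hy]
      simp only [Pi.pow_apply, Circle.coe_pow, hz, ← Complex.exp_nat_mul, ← Complex.exp_add]
      congr 1
      push_cast
      ring

/-- Any phases are attained at a common frequency by delays arbitrarily close to given ones. -/
theorem exists_delays_near {m : ℕ} (z : Fin m → Circle) {τ : Fin m → ℝ}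
    {Q : (Fin m → ℝ) → Prop} (hQ : ∀ᶠ r in 𝓝 τ, Q r) :
    ∃ r, Q r ∧ ∃ ω : ℝ, 0 < ω ∧ ∀ i, (z i : ℂ) = Complex.exp (-(Complex.I * ω) * r i) := by
  set θ : Fin m → ℝ := fun i => -Complex.arg (z i) with hθ
  -- Rounding `ω * τ i` to the nearest number congruent to `θ i` modulo `2π` moves the delay by at
  -- most `π / ω`, which tends to `0`.
  set N : ℝ → Fin m → ℤ := fun ω i => round ((ω * τ i - θ i) / (2 * Real.pi)) with hN
  set r : ℝ → Fin m → ℝ := fun ω i => (θ i + 2 * Real.pi * N ω i) / ω with hr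
  have hlim : Tendsto r atTop (𝓝 τ) := by
    refine tendsto_pi_nhds.mpr fun i => ?_
    rw [tendsto_iff_norm_sub_tendsto_zero]
    have hπ : Tendsto (fun ω : ℝ => Real.pi / ω) atTop (𝓝 0) :=
      tendsto_const_nhds.div_atTop tendsto_id
    refine squeeze_zero' (Eventually.of_forall fun _ => norm_nonneg _) ?_ hπ
    filter_upwards [eventually_gt_atTop 0] with ω hω
    have h1 := abs_sub_round ((ω * τ i - θ i) / (2 * Real.pi))
    have hpi := Real.pi_pos
    have h2 : r ω i - τ i
        = -((ω * τ i - θ i) / (2 * Real.pi) - N ω i) * (2 * Real.pi) / ω := by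
      simp only [hr]
      field_simp
      ring
    rw [h2, Real.norm_eq_abs, abs_div, abs_mul, abs_neg, abs_of_pos hω, abs_of_pos Real.two_pi_pos]
    gcongr
    calc _ ≤ 1 / 2 * (2 * Real.pi) := by gcongr
      _ = Real.pi := by ring
  obtain ⟨ω, hω, hω0⟩ := ((hlim.eventually hQ).and (eventually_gt_atTop 0)).exists
  refine ⟨r ω, hω, ω, hω0, fun i => ?_⟩
  have hω0' : (ω : ℂ) ≠ 0 := by exact_mod_cast hω0.ne'
  have e : -(Complex.I * ω) * ((r ω i : ℝ) : ℂ)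
      = Complex.arg (z i) * Complex.I - N ω i * (2 * Real.pi * Complex.I) := by
    simp only [hr, hθ]
    push_cast
    field_simp
    ring
  rw [e, Complex.exp_sub, Complex.exp_int_mul_two_pi_mul_I, div_one]
  have := Complex.norm_mul_exp_arg_mul_I (z i : ℂ)
  rw [Circle.norm_coe] at this
  simpa using this.symm

/-! ### Complexification and the rescaled characteristic matrix. -/

namespace DDAE

variable {k l o : ℕ}

theorem toComplex_mul (M : Matrix (Fin k) (Fin l) ℝ) (N : Matrix (Fin l) (Fin o) ℝ) :
    toComplex (M * N) = toComplex M * toComplex N :=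
  Matrix.map_mul (f := Complex.ofRealHom)

theorem toComplex_add (M N : Matrix (Fin k) (Fin l) ℝ) :
    toComplex (M + N) = toComplex M + toComplex N :=
  Matrix.map_add _ Complex.ofReal_add M N

theorem toComplex_zero : toComplex (0 : Matrix (Fin k) (Fin l) ℝ) = 0 :=
  Matrix.map_zero _ Complex.ofReal_zero

theorem toComplex_one : toComplex (1 : Matrix (Fin k) (Fin k) ℝ) = 1 :=
  Matrix.map_one _ Complex.ofReal_zero Complex.ofReal_one

theorem re_toComplex_mulVec (M : Matrix (Fin k) (Fin l) ℝ) (v : Fin l → ℂ) (i : Fin k) :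
    ((toComplex M *ᵥ v) i).re = (M *ᵥ fun j => (v j).re) i := by
  simp [toComplex, Matrix.mulVec, dotProduct]

theorem abs_le_euclNorm (v : Fin k → ℝ) (i : Fin k) : |v i| ≤ euclNorm v :=
  PiLp.norm_apply_le (WithLp.toLp 2 v) i

theorem continuous_euclNorm : Continuous (euclNorm (k := k)) :=
  (PiLp.continuous_toLp 2 _).norm

theorem sigmaOne_le (M : Matrix (Fin k) (Fin l) ℂ) :
    sigmaOne M ≤ ‖LinearMap.toContinuousLinearMap (Matrix.toEuclideanLin M)‖ :=
  LinearMap.singularValues_le_norm _ 0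

theorem continuous_opNorm_toEuclideanLin :
    Continuous fun M : Matrix (Fin k) (Fin l) ℂ =>
      ‖LinearMap.toContinuousLinearMap (Matrix.toEuclideanLin M)‖ := by
  refine Continuous.norm ?_
  exact LinearMap.continuous_of_finiteDimensional
    ((LinearMap.toContinuousLinearMap (𝕜 := ℂ) (E := EuclideanSpace ℂ (Fin l))
      (F' := EuclideanSpace ℂ (Fin k))).toLinearMap ∘ₗ
      (Matrix.toEuclideanLin (𝕜 := ℂ) (m := Fin k) (n := Fin l)).toLinearMap)

namespace System

variable {n m p q : ℕ} (S : System n m p q)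

/-- The matrix `A₀ + ∑ i, z i A i`. -/
def delayMatrix (z : Fin m → ℂ) : Matrix (Fin n) (Fin n) ℂ :=
  toComplex S.A₀ + ∑ i, z i • toComplex (S.A i)

/-- With the projection `Q` annihilating the range of `E`, the matrix
`E - (μ (1 - Q) + Q) (A₀ + ∑ i, z i A i)`, a rescaling of the characteristic matrix. -/
def scaledMatrix (Q : Matrix (Fin n) (Fin n) ℂ) (μ : ℂ) (z : Fin m → ℂ) :
    Matrix (Fin n) (Fin n) ℂ :=
  toComplex S.E - (μ • (1 - Q) + Q) * S.delayMatrix z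

theorem charMatrix_eq (τ : Fin m → ℝ) (lam : ℂ) :
    S.charMatrix τ lam
      = lam • toComplex S.E - S.delayMatrix fun i => Complex.exp (-lam * τ i) := by
  simp only [charMatrix, delayMatrix, sub_sub]

theorem algMatrix_eq (U V : Matrix (Fin n) (Fin k) ℝ) (τ : Fin m → ℝ) (lam : ℂ) :
    S.algMatrix U V τ lam
      = toComplex Uᵀ * (S.delayMatrix fun i => Complex.exp (-lam * τ i)) * toComplex V := by
  simp only [algMatrix, delayMatrix, toComplex_mul, Matrix.mul_add, Matrix.add_mul,
    Matrix.mul_sum, Matrix.sum_mul, Matrix.mul_smul, Matrix.smul_mul]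

theorem scaledMatrix_zero_left (P : Matrix (Fin k) (Fin n) ℂ) (W : Matrix (Fin n) (Fin k) ℂ)
    (z : Fin m → ℂ) :
    S.scaledMatrix (W * P) 0 z = toComplex S.E - W * P * S.delayMatrix z := by
  simp [scaledMatrix]

/-- As `Q * E = 0`, only the factor `lam⁻¹` meets `lam • E`, so no unbounded coefficient survives
for large `lam`. -/
theorem mul_charMatrix {Q : Matrix (Fin n) (Fin n) ℂ} (hQE : Q * toComplex S.E = 0)
    (τ : Fin m → ℝ) {lam : ℂ} (hlam : lam ≠ 0) :
    (lam⁻¹ • (1 - Q) + Q) * S.charMatrix τ lam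
      = S.scaledMatrix Q lam⁻¹ fun i => Complex.exp (-lam * τ i) := by
  rw [charMatrix_eq, Matrix.mul_sub, scaledMatrix]
  congr 1
  rw [Matrix.mul_smul, Matrix.add_mul, hQE, Matrix.smul_mul, Matrix.sub_mul, hQE, add_zero,
    sub_zero, Matrix.one_mul, smul_smul, mul_inv_cancel₀ hlam, one_smul]

theorem continuous_delayMatrix : Continuous S.delayMatrix := by
  unfold delayMatrix
  fun_prop

theorem continuous_scaledMatrix (Q : Matrix (Fin n) (Fin n) ℂ) :
    Continuous fun x : ℂ × (Fin m → ℂ) => S.scaledMatrix Q x.1 x.2 := by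
  have h := S.continuous_delayMatrix.comp (continuous_snd (X := ℂ))
  unfold scaledMatrix
  refine continuous_const.sub (Continuous.mul ?_ h)
  fun_prop

theorem differentiable_det_scaledMatrix (Q : Matrix (Fin n) (Fin n) ℂ) :
    Differentiable ℂ fun x : ℂ × (Fin m → ℂ) => (S.scaledMatrix Q x.1 x.2).det := by
  simp only [Matrix.det_apply', scaledMatrix, delayMatrix, Matrix.sub_apply, Matrix.mul_apply,
    Matrix.add_apply, Matrix.smul_apply, Matrix.sum_apply, smul_eq_mul]
  fun_prop

/-! ### From stability to nonsingularity on the torus. -/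

/-- Solutions are real-valued, so a characteristic root enters through the real part of `exp (lam *
t) • v`. -/
theorem isSolution_exp {r : Fin m → ℝ} {lam : ℂ} {v : Fin n → ℂ}
    (hv : S.charMatrix r lam *ᵥ v = 0) :
    S.IsSolution r fun t i => (Complex.exp (lam * t) * v i).re where
  continuousOn := by
    refine Continuous.continuousOn ?_
    fun_prop
  equation t _ := by
    refine HasDerivAt.hasDerivWithinAt ?_
    have hE : lam • (toComplex S.E *ᵥ v)
        = toComplex S.A₀ *ᵥ v + ∑ i, Complex.exp (-lam * r i) • (toComplex (S.A i) *ᵥ v) := by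
      rw [charMatrix_eq, Matrix.sub_mulVec, sub_eq_zero] at hv
      simpa only [delayMatrix, Matrix.smul_mulVec, Matrix.add_mulVec, Matrix.sum_mulVec] using hv
    have key (M : Matrix (Fin n) (Fin n) ℝ) (s : ℝ) :
        (M *ᵥ fun i => (Complex.exp (lam * s) * v i).re)
          = fun i => (Complex.exp (lam * s) * (toComplex M *ᵥ v) i).re := by
      funext i
      have h := re_toComplex_mulVec M (Complex.exp (lam * s) • v) i
      rw [Matrix.mulVec_smul] at h
      exact h.symm
    simp only [key]
    rw [hasDerivAt_pi]
    intro j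
    have hexp : HasDerivAt (fun s : ℝ => Complex.exp (lam * s)) (lam * Complex.exp (lam * t)) t := by
      have h := ((hasDerivAt_id (t : ℂ)).const_mul lam).cexp.comp_ofReal
      simpa [mul_comm] using h
    have hd : HasDerivAt (fun s : ℝ => (Complex.exp (lam * s) * (toComplex S.E *ᵥ v) j).re)
        (lam * Complex.exp (lam * t) * (toComplex S.E *ᵥ v) j).re t := by
      exact Complex.reCLM.hasFDerivAt.comp_hasDerivAt t (hexp.mul_const _)
    refine hd.congr_deriv ?_
    have hj := congrArg (fun w => (Complex.exp (lam * t) * w j).re) hE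
    simp only [Pi.smul_apply, smul_eq_mul, Pi.add_apply, Finset.sum_apply, mul_add,
      Finset.mul_sum, Complex.add_re, Complex.re_sum] at hj
    rw [mul_comm lam, mul_assoc, hj, Pi.add_apply, Finset.sum_apply]
    congr 1
    refine Finset.sum_congr rfl fun i _ => ?_
    rw [← mul_assoc, ← Complex.exp_add]
    congr 4
    push_cast
    ring

/-- Exponential stability bounds the characteristic roots away from the right half-plane. -/
theorem ExpStable.exists_det_charMatrix_ne_zero {S : System n m p q} {r : Fin m → ℝ}
    (hS : S.ExpStable r) :
    ∃ α : ℝ, 0 < α ∧ ∀ lam : ℂ, -α < lam.re → (S.charMatrix r lam).det ≠ 0 := by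
  obtain ⟨K, α, _, hα, hbound⟩ := hS
  refine ⟨α, hα, fun lam hlam hdet => ?_⟩
  obtain ⟨v, hv0, hv⟩ := Matrix.exists_mulVec_eq_zero_iff.mpr hdet
  obtain ⟨i, hi⟩ := Function.ne_iff.mp hv0
  have hdecay (w : Fin n → ℂ) (hw : S.charMatrix r lam *ᵥ w = 0) :
      ∃ c, ∀ t : ℝ, 0 ≤ t → |(Complex.exp (lam * t) * w i).re| ≤ c * Real.exp (-α * t) := by
    have hsol := S.isSolution_exp hw
    exact ⟨K * sSup _, fun t ht => (abs_le_euclNorm _ i).trans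
      ((hbound _ hsol t ht).trans_eq (mul_right_comm _ _ _))⟩
  obtain ⟨c₁, h₁⟩ := hdecay v hv
  -- Rotating `v` by `I` turns the real part into minus the imaginary part, so the two bounds
  -- together control the modulus.
  obtain ⟨c₂, h₂⟩ := hdecay (Complex.I • v) (by rw [Matrix.mulVec_smul, hv, smul_zero])
  have hle (t : ℝ) (ht : 0 ≤ t) : Real.exp ((lam.re + α) * t) * ‖v i‖ ≤ c₁ + c₂ := by
    have h3 := Complex.norm_le_abs_re_add_abs_im (Complex.exp (lam * t) * v i)
    have h4 : |(Complex.exp (lam * t) * v i).im|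
        = |(Complex.exp (lam * t) * (Complex.I • v) i).re| := by
      rw [Pi.smul_apply, smul_eq_mul, mul_left_comm, Complex.I_mul_re, abs_neg]
    have h5 : ‖Complex.exp (lam * t) * v i‖ = Real.exp (lam.re * t) * ‖v i‖ := by
      rw [norm_mul, Complex.norm_exp, Complex.re_mul_ofReal]
    have h6 : Real.exp (lam.re * t) * ‖v i‖ ≤ (c₁ + c₂) * Real.exp (-α * t) := by
      rw [add_mul, ← h5]
      linarith [h₁ t ht, h₂ t ht]
    calc Real.exp ((lam.re + α) * t) * ‖v i‖
        = Real.exp (lam.re * t) * ‖v i‖ * Real.exp (α * t) := by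
          rw [add_mul, Real.exp_add, mul_right_comm]
      _ ≤ (c₁ + c₂) * Real.exp (-α * t) * Real.exp (α * t) := by gcongr
      _ = c₁ + c₂ := by
          rw [mul_assoc, ← Real.exp_add, neg_mul, neg_add_cancel, Real.exp_zero, mul_one]
  have hlim : Tendsto (fun t : ℝ => Real.exp ((lam.re + α) * t) * ‖v i‖) atTop atTop :=
    (Real.tendsto_exp_atTop.comp (tendsto_id.const_mul_atTop (by linarith))).atTop_mul_const
      (norm_pos_iff.mpr hi)
  obtain ⟨t, ht, ht0⟩ := ((hlim.eventually_gt_atTop (c₁ + c₂)).and (eventually_ge_atTop 0)).exists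
  exact absurd (hle t ht0) (not_le.mpr ht)

/-- Strong stability forces `Uᵀ (A₀ + ∑ i, z i A i) V` to be nonsingular on the whole torus. -/
theorem StronglyExpStable.det_scaledMatrix_ne_zero {S : System n m p q} {τ : Fin m → ℝ}
    (hτ : ∀ i, 0 < τ i) (hstab : S.StronglyExpStable τ) {Q : Matrix (Fin n) (Fin n) ℂ}
    (hQ : IsIdempotentElem Q) (hQE : Q * toComplex S.E = 0)
    (h0 : (S.scaledMatrix Q 0 0).det ≠ 0) (z : Fin m → Circle) :
    (S.scaledMatrix Q 0 fun i => (z i : ℂ)).det ≠ 0 := by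
  intro hzero
  obtain ⟨ε, hε, hstab⟩ := hstab
  have hev : ∀ᶠ r : Fin m → ℝ in 𝓝 τ, (∀ i, 0 < r i) ∧ euclNorm (r - τ) < ε := by
    refine (eventually_all.mpr fun i => ?_).and ?_
    · exact (continuous_apply i).continuousAt.eventually_const_lt (hτ i)
    · have hc : Continuous fun r : Fin m → ℝ => euclNorm (r - τ) :=
        continuous_euclNorm.comp (continuous_id.sub continuous_const)
      exact hc.continuousAt.eventually_lt continuousAt_const (by simpa [euclNorm] using hε)
  obtain ⟨r, ⟨hr, hrτ⟩, ω, hω, hz⟩ := exists_delays_near z hev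
  -- The decay rate `α` depends on `r`, so the strip width `α / 2` can only be chosen once `r` is
  -- fixed.
  obtain ⟨α, hα, hroots⟩ := (hstab r (fun i => (hr i).le) hrτ).exists_det_charMatrix_ne_zero
  obtain ⟨lam, hlam, hre, hdet⟩ := exists_near_imaginary_zero
    (Φ := fun μ z => (S.scaledMatrix Q μ z).det) (S.differentiable_det_scaledMatrix Q) h0 hr hω hz
    hzero (half_pos hα)
  rw [← S.mul_charMatrix hQE r hlam, Matrix.det_mul] at hdet
  rcases mul_eq_zero.mp hdet with h | h
  · exact (Matrix.isUnit_det_smul_add_of_isIdempotentElem hQ (inv_ne_zero hlam)).ne_zero h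
  · exact hroots lam (by linarith [(abs_le.mp hre).1]) h

/-! ### Uniform convergence as `μ → 0`. -/

theorem continuousAt_inv_scaledMatrix (Q : Matrix (Fin n) (Fin n) ℂ) {μ : ℂ} {z : Fin m → ℂ}
    (h : (S.scaledMatrix Q μ z).det ≠ 0) :
    ContinuousAt (fun x : ℂ × (Fin m → ℂ) => (S.scaledMatrix Q x.1 x.2)⁻¹) (μ, z) := by
  simp only [Matrix.inv_def, Ring.inverse_eq_inv']
  have hdet : ContinuousAt (fun x : ℂ × (Fin m → ℂ) => (S.scaledMatrix Q x.1 x.2).det) (μ, z) :=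
    (S.continuous_scaledMatrix Q).matrix_det.continuousAt
  have hadj : ContinuousAt (fun x : ℂ × (Fin m → ℂ) => (S.scaledMatrix Q x.1 x.2).adjugate)
      (μ, z) := (S.continuous_scaledMatrix Q).matrix_adjugate.continuousAt
  exact (hdet.inv₀ h).smul hadj

theorem continuousAt_scaled_transfer (Q : Matrix (Fin n) (Fin n) ℂ) {μ : ℂ} {z : Fin m → ℂ}
    (h : (S.scaledMatrix Q μ z).det ≠ 0) :
    ContinuousAt (fun x : ℂ × (Fin m → ℂ) => toComplex S.C *
      ((S.scaledMatrix Q x.1 x.2)⁻¹ * (x.1 • (1 - Q) + Q)) * toComplex S.B) (μ, z) := by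
  have hd : ContinuousAt (fun x : ℂ × (Fin m → ℂ) => x.1 • (1 - Q) + Q) (μ, z) := by fun_prop
  have hm : Continuous fun X : Matrix (Fin n) (Fin n) ℂ => toComplex S.C * X * toComplex S.B := by
    fun_prop
  exact ContinuousAt.comp (f := fun x : ℂ × (Fin m → ℂ) =>
    (S.scaledMatrix Q x.1 x.2)⁻¹ * (x.1 • (1 - Q) + Q)) hm.continuousAt
    ((S.continuousAt_inv_scaledMatrix Q h).mul hd)

/-- As `μ → 0`, the rescaled transfer function converges to its limit uniformly on the torus. -/
theorem eventually_scaled_transfer_close {Q : Matrix (Fin n) (Fin n) ℂ}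
    (hne : ∀ z : Fin m → Circle, (S.scaledMatrix Q 0 fun i => (z i : ℂ)).det ≠ 0) {γ : ℝ}
    (hγ : 0 < γ) :
    ∀ᶠ μ : ℂ in 𝓝 0, ∀ z ∈ (Set.univ : Set (Fin m → Circle)),
      (S.scaledMatrix Q μ fun i => (z i : ℂ)).det ≠ 0 ∧
      sigmaOne (toComplex S.C *
          ((S.scaledMatrix Q μ fun i => (z i : ℂ))⁻¹ * (μ • (1 - Q) + Q)) * toComplex S.B
        - toComplex S.C *
          ((S.scaledMatrix Q 0 fun i => (z i : ℂ))⁻¹ * ((0 : ℂ) • (1 - Q) + Q))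
            * toComplex S.B) < γ := by
  refine isCompact_univ.eventually_forall_of_forall_eventually fun z _ => ?_
  set T : ℂ × (Fin m → ℂ) → Matrix (Fin q) (Fin p) ℂ := fun x => toComplex S.C *
      ((S.scaledMatrix Q x.1 x.2)⁻¹ * (x.1 • (1 - Q) + Q)) * toComplex S.B
  have hT : ContinuousAt T (0, fun i => (z i : ℂ)) := S.continuousAt_scaled_transfer Q (hne z)
  have hcoe : Continuous fun y : Fin m → Circle => fun i => (y i : ℂ) := by fun_prop
  have h1 : Continuous fun x : ℂ × (Fin m → Circle) => (x.1, fun i => (x.2 i : ℂ)) :=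
    continuous_fst.prodMk (hcoe.comp continuous_snd)
  have h2 : Continuous fun x : ℂ × (Fin m → Circle) => ((0 : ℂ), fun i => (x.2 i : ℂ)) :=
    continuous_const.prodMk (hcoe.comp continuous_snd)
  have hdet : ∀ᶠ x : ℂ × (Fin m → Circle) in 𝓝 (0, z),
      (S.scaledMatrix Q x.1 fun i => (x.2 i : ℂ)).det ≠ 0 :=
    (((S.differentiable_det_scaledMatrix Q).continuous.comp h1).tendsto (0, z)).eventually_ne
      (hne z)
  refine hdet.and ?_
  have hT1 : ContinuousAt (fun x : ℂ × (Fin m → Circle) => T (x.1, fun i => (x.2 i : ℂ)))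
      (0, z) :=
    ContinuousAt.comp (g := T) hT h1.continuousAt
  have hT2 : ContinuousAt (fun x : ℂ × (Fin m → Circle) => T (0, fun i => (x.2 i : ℂ)))
      (0, z) :=
    ContinuousAt.comp (g := T) hT h2.continuousAt
  -- Continuity is needed only for the operator norm, which dominates `σ₁`; the difference vanishes
  -- at `μ = 0`.
  have hnorm := ContinuousAt.comp (f := fun x : ℂ × (Fin m → Circle) =>
    T (x.1, fun i => (x.2 i : ℂ)) - T (0, fun i => (x.2 i : ℂ)))
    continuous_opNorm_toEuclideanLin.continuousAt (hT1.sub hT2)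
  have hev := hnorm.eventually_lt (continuousAt_const (y := γ)) (by
    simp only [Function.comp_apply, sub_self, map_zero, norm_zero]
    exact hγ)
  exact hev.mono fun x hx => (sigmaOne_le _).trans_lt hx

end System

end DDAE

/-! ### Assembly of the theorem. -/

theorem mainTheorem3 {n m p q k : ℕ} (S : DDAE.System n m p q) (τ : Fin m → ℝ)
    (hτ : ∀ i, 0 < τ i)
    (hrank : S.E.rank + k = n)
    (U V : Matrix (Fin n) (Fin k) ℝ)
    (hU : Uᵀ * S.E = 0) (hUind : LinearIndependent ℝ U.col)
    (hV : S.E * V = 0) (hVind : LinearIndependent ℝ V.col)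
    (hA₀ : IsUnit (Uᵀ * S.A₀ * V).det)
    (hstab : S.StronglyExpStable τ) :
    ∀ γ : ℝ, 0 < γ → ∃ Ω : ℝ, 0 < Ω ∧ ∀ ω : ℝ, Ω < ω →
      IsUnit (S.charMatrix τ (Complex.I * (ω : ℂ))).det ∧
      IsUnit (S.algMatrix U V τ (Complex.I * (ω : ℂ))).det ∧
      DDAE.sigmaOne (S.transfer τ (Complex.I * (ω : ℂ))
        - S.asympTransfer U V τ (Complex.I * (ω : ℂ))) < γ := by
  intro γ hγ
  obtain ⟨LU, hLU⟩ := Matrix.exists_leftInverse_of_linearIndependent_col hUind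
  obtain ⟨LV, hLV⟩ := Matrix.exists_leftInverse_of_linearIndependent_col hVind
  obtain ⟨X, hX⟩ := Matrix.exists_mul_add_mul_eq_one (by simpa using hrank) hV hLV
  have hW : Uᵀ * LUᵀ = 1 := by rw [← Matrix.transpose_mul, hLU, Matrix.transpose_one]
  set W := DDAE.toComplex LUᵀ with hWdef
  set P := DDAE.toComplex Uᵀ with hPdef
  have hPE : P * DDAE.toComplex S.E = 0 := by
    rw [hPdef, ← DDAE.toComplex_mul, hU, DDAE.toComplex_zero]
  have hEV : DDAE.toComplex S.E * DDAE.toComplex V = 0 := by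
    rw [← DDAE.toComplex_mul, hV, DDAE.toComplex_zero]
  have hPW : P * W = 1 := by
    rw [hPdef, hWdef, ← DDAE.toComplex_mul, hW, DDAE.toComplex_one]
  have hLVc : DDAE.toComplex LV * DDAE.toComplex V = 1 := by
    rw [← DDAE.toComplex_mul, hLV, DDAE.toComplex_one]
  have hXc : DDAE.toComplex X * DDAE.toComplex S.E
      + DDAE.toComplex V * DDAE.toComplex LV = 1 := by
    rw [← DDAE.toComplex_mul, ← DDAE.toComplex_mul, ← DDAE.toComplex_add, hX,
      DDAE.toComplex_one]
  have hQ : IsIdempotentElem (W * P) := by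
    rw [IsIdempotentElem, Matrix.mul_assoc, ← Matrix.mul_assoc P, hPW, Matrix.one_mul]
  have hQE : W * P * DDAE.toComplex S.E = 0 := by rw [Matrix.mul_assoc, hPE, Matrix.mul_zero]
  have hiff (z : Fin m → ℂ) : (S.scaledMatrix (W * P) 0 z).det = 0
      ↔ (P * S.delayMatrix z * DDAE.toComplex V).det = 0 := by
    rw [S.scaledMatrix_zero_left]
    exact Matrix.det_sub_mul_eq_zero_iff hPE hEV hPW hLVc hXc
  -- At `z = 0` the compression is `Uᵀ A₀ V`, nonsingular by assumption.
  have h0 : (S.scaledMatrix (W * P) 0 0).det ≠ 0 := by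
    rw [Ne, hiff]
    have e : P * S.delayMatrix 0 * DDAE.toComplex V = DDAE.toComplex (Uᵀ * S.A₀ * V) := by
      simp [DDAE.System.delayMatrix, DDAE.toComplex_mul, hPdef]
    rw [e]
    have hdet : (DDAE.toComplex (Uᵀ * S.A₀ * V)).det = (((Uᵀ * S.A₀ * V).det : ℝ) : ℂ) :=
      (RingHom.map_det Complex.ofRealHom _).symm
    rw [hdet]
    exact_mod_cast hA₀.ne_zero
  have hne := hstab.det_scaledMatrix_ne_zero hτ hQ hQE h0
  have hlim : Tendsto (fun ω : ℝ => (Complex.I * (ω : ℂ))⁻¹) atTop (𝓝 0) := by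
    refine tendsto_zero_iff_norm_tendsto_zero.mpr ?_
    have e : (fun ω : ℝ => ‖(Complex.I * (ω : ℂ))⁻¹‖) = fun ω : ℝ => |ω|⁻¹ := by
      funext ω
      simp
    rw [e]
    exact tendsto_inv_atTop_zero.comp tendsto_abs_atTop_atTop
  obtain ⟨Ω, hΩ⟩ := eventually_atTop.mp
    (hlim.eventually (S.eventually_scaled_transfer_close hne hγ))
  -- The `1` keeps the threshold positive and `lam` nonzero.
  refine ⟨max Ω 1, by positivity, fun ω hω => ?_⟩
  have hω0 : 0 < ω := one_pos.trans ((le_max_right _ _).trans_lt hω)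
  set lam : ℂ := Complex.I * (ω : ℂ) with hlamdef
  have hlam : lam ≠ 0 := mul_ne_zero Complex.I_ne_zero (by exact_mod_cast hω0.ne')
  -- On the imaginary axis the delay exponentials have modulus one.
  set z : Fin m → Circle := fun i => Circle.exp (-(ω * τ i)) with hz
  have hzexp : (fun i => (z i : ℂ)) = fun i => Complex.exp (-lam * τ i) := by
    funext i
    rw [hz, Circle.coe_exp, hlamdef]
    congr 1
    push_cast
    ring
  obtain ⟨hdet, hclose⟩ := hΩ ω ((le_max_left _ _).trans hω.le) z (Set.mem_univ z)
  have hdet0 := hne z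
  rw [hzexp] at hdet hclose hdet0
  have hmul := S.mul_charMatrix hQE τ hlam
  have hD := Matrix.isUnit_det_smul_add_of_isIdempotentElem hQ (inv_ne_zero hlam)
  rw [← hmul] at hdet hclose
  have hchar : IsUnit (S.charMatrix τ lam).det := by
    rw [Matrix.det_mul] at hdet
    exact (right_ne_zero_of_mul hdet).isUnit
  have halg : IsUnit (S.algMatrix U V τ lam).det := by
    rw [S.algMatrix_eq]
    exact isUnit_iff_ne_zero.mpr ((hiff _).not.mp hdet0)
  refine ⟨hchar, halg, ?_⟩
  -- The scaling factor cancels in `T`; at `μ = 0` it reduces to `W * P`, which yields `T_a`.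
  convert hclose using 3
  · rw [DDAE.System.transfer, Matrix.mul_inv_rev, Matrix.mul_assoc (S.charMatrix τ lam)⁻¹,
      Matrix.nonsing_inv_mul _ hD, Matrix.mul_one]
  · rw [S.algMatrix_eq] at halg
    rw [S.scaledMatrix_zero_left] at hdet0 ⊢
    rw [zero_smul, zero_add, Matrix.inv_sub_mul_mul hEV hdet0.isUnit halg,
      DDAE.System.asympTransfer, S.algMatrix_eq, DDAE.toComplex_mul, DDAE.toComplex_mul]
    simp only [Matrix.mul_neg, Matrix.neg_mul, Matrix.mul_assoc, hPdef]
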